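/- Let $\lambda>0$, $\alpha>2$, $h>0$, $r>0$ and $s\ge 0$. Let $\Phi=\{x_i\}\subset\mathbb R^2$ be a homogeneous Poisson point process of density $\lambda$ (the horizontal locations of the base stations), and let the fading gains $g_{x_i}$ be i.i.d. exponential random variables of mean $1$, independent of $\Phi$ (Rayleigh fading). For $t\ge0$ and a base station height $H\in\{0,h\}$ let $\ell(t,H)=(t^2+H^2)^{-\alpha/2}$. Given that the serving base station is at horizontal distance $r$ from the origin, the interfering base stations are distributed as the points of $\Phi$ at horizontal distance at least $\nu(r)$, where $\nu(r)=r$ for closest and $\nu(r)=0$ for strongest association; thus the interference is $I_H=\sum_{y\in\Phi,\ \|y\|\ge\nu(r)} g_y\,\ell(\|y\|,H)$. Its Laplace transform $\mathbb E[e^{-sI_H}]$ is denoted by $\mathcal L^{(\mathrm C)}_{I}(s)$ for closest and by $\mathcal L^{(\mathrm S)}_{I}(s)$ for strongest association if $H=h$ (elevated base stations), and by $\mathcal L^{\mathrm{NLOS},(\mathrm C)}_{I}(s)$ and $\mathcal L^{\mathrm{NLOS},(\mathrm S)}_{I}(s)$ if $H=0$ (non-elevated base stations). Put $$\eta(s,m,r)={}_2F_1\Big(m,-\tfrac2\alpha;1-\tfrac2\alpha;-\tfrac{s}{m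 r^{\alpha}}\Big),\qquad \zeta(m)=-\frac{\Gamma(m+\frac2\alpha)\,\Gamma(-\frac2\alpha)}{\alpha\,\Gamma(m)},$$ where ${}_2F_1$ is the Gauss hypergeometric function on $\mathbb C\setminus[1,\infty)$ (the analytic continuation of the hypergeometric series). Then all these interference sums are almost surely finite, and the following hold. (i) With non-elevated base stations, $$\mathcal L^{\mathrm{NLOS},(\mathrm C)}_{I}(s)=\exp\big(-\pi\lambda r^2(\eta(s,1,r)-1)\big),\qquad \mathcal L^{\mathrm{NLOS},(\mathrm S)}_{I}(s)=\exp\big(-2\pi\lambda\,\zeta(1)\,s^{2/\alpha}\big).$$ (ii) With elevated base stations, for both association policies, $$\mathbb E[e^{-sI_h}]=\exp\Big(-2\pi\lambda\int_{\nu(r)}^\infty\Big(1-\frac1{1+s\,\ell(t,h)}\Big)t\,\mathrm dt\Big).$$ (iii) For closest association, $$\mathcal L^{(\mathrm C)}_{I}(s)=\mathcal L^{\mathrm{NLOS},(\mathrm C)}_{I}(s)\,\exp\Big(2\pi\lambda\int_r^{\sqrt{r^2+h^2}}\Big(1-\frac1{1+s t^{-\alpha}}\Big)t\,\mathrm dt\Big)=\exp\Big(-\pi\lambda(r^2+h^2)\big(\eta(s,1,\sqrt{r^2+h^2})-1\big)\Big).$$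 (iv) For strongest association, $$\mathcal L^{(\mathrm S)}_{I}(s)=\mathcal L^{\mathrm{NLOS},(\mathrm S)}_{I}(s)\,\exp\Big(2\pi\lambda\int_0^{h}\Big(1-\frac1{1+s t^{-\alpha}}\Big)t\,\mathrm dt\Big)=\exp\Big(-\pi\lambda h^2\big(\eta(s,1,h)-1\big)\Big).$$ -/

import Mathlib

open MeasureTheory ProbabilityTheory
open scoped ENNReal NNReal

noncomputable section

namespace ElevatedBS

/-! ### The Gauss hypergeometric function on the cut plane -/

/-- The complex plane without the ray `[1, ∞)`. -/
def cutPlane : Set ℂ := {z | 1 - z ∈ Complex.slitPlane}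

/-- `F` is the principal branch of the Gauss hypergeometric function `₂F₁(a, b; c; ·)`: it is
holomorphic on the plane cut along `[1, ∞)` and is the sum of the hypergeometric series on the
open unit disc. -/
def IsGaussHypergeometric (a b c : ℂ) (F : ℂ → ℂ) : Prop :=
  DifferentiableOn ℂ F cutPlane ∧ ∀ z ∈ Metric.ball (0 : ℂ) 1, F z = ₂F₁ a b c z

open Classical in
/-- The Gauss hypergeometric function on the cut plane, i.e. the analytic continuation of the
hypergeometric series. (Mathlib's `₂F₁` is the sum of the series only, with the value `0` outside
the disc of convergence, whereas here the argument ranges over the whole negative half-line.) -/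
def gaussHypergeometric (a b c z : ℂ) : ℂ :=
  if H : ∃ F : ℂ → ℂ, IsGaussHypergeometric a b c F then H.choose z else 0

lemma isOpen_cutPlane : IsOpen cutPlane :=
  Complex.isOpen_slitPlane.preimage (by fun_prop)

lemma isPreconnected_cutPlane : IsPreconnected cutPlane := by
  have h1 : IsPreconnected Complex.slitPlane :=
    (Complex.starConvex_one_slitPlane.isPathConnected
      Complex.one_mem_slitPlane).isConnected.isPreconnected
  have h2 : cutPlane = (fun w : ℂ => 1 - w) '' Complex.slitPlane := by
    ext z
    constructor
    · intro hz
      exact ⟨1 - z, hz, by simp⟩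
    · rintro ⟨w, hw, rfl⟩
      simpa [cutPlane] using hw
  rw [h2]
  exact h1.image _ (by fun_prop)

/-- The continuation is unique, so `gaussHypergeometric` does not depend on a choice. -/
lemma gaussHypergeometric_eq {a b c : ℂ} {F : ℂ → ℂ} (hF : IsGaussHypergeometric a b c F)
    {z : ℂ} (hz : z ∈ cutPlane) : gaussHypergeometric a b c z = F z := by
  have H : ∃ F : ℂ → ℂ, IsGaussHypergeometric a b c F := ⟨F, hF⟩
  have hG := H.choose_spec
  rw [gaussHypergeometric, dif_pos H]
  have h0 : (0 : ℂ) ∈ cutPlane := by simp [cutPlane]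
  refine (hG.1.analyticOnNhd isOpen_cutPlane).eqOn_of_preconnected_of_eventuallyEq
    (hF.1.analyticOnNhd isOpen_cutPlane) isPreconnected_cutPlane h0 ?_ hz
  filter_upwards [Metric.ball_mem_nhds (0 : ℂ) one_pos] with w hw
  rw [hG.2 w hw, hF.2 w hw]

/-- `η(s, m, r) = ₂F₁(m, -2/α; 1 - 2/α; -s / (m r ^ α))`. The parameters are real and the argument
is real and less than `1`, so the value is real. -/
def eta (α s m r : ℝ) : ℝ :=
  (gaussHypergeometric (m : ℂ) ((-(2 / α) : ℝ) : ℂ) ((1 - 2 / α : ℝ) : ℂ)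
    ((-(s / (m * r ^ α)) : ℝ) : ℂ)).re

/-- `ζ(m) = - Γ(m + 2/α) Γ(-2/α) / (α Γ(m))`. -/
def zeta (α m : ℝ) : ℝ :=
  -(Real.Gamma (m + 2 / α) * Real.Gamma (-(2 / α)) / (α * Real.Gamma m))

/-! ### Poisson point processes with Rayleigh fading -/

/-- The random measure `N` is (the counting measure of) a Poisson point process with intensity
measure `μ`: the number of points in a set of finite `μ`-measure is Poisson with mean the measure
of that set, and the numbers of points in disjoint sets are independent. -/
structure IsPoissonPointProcess {Ω E : Type*} [MeasurableSpace Ω] [MeasurableSpace E]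
    (P : Measure Ω) (μ : Measure E) (N : Ω → Measure E) : Prop where
  measurable : Measurable N
  law : ∀ A : Set E, MeasurableSet A → μ A ≠ ∞ →
    HasLaw (fun ω => N ω A) ((poissonMeasure (μ A).toNNReal).map (Nat.cast : ℕ → ℝ≥0∞)) P
  indep : ∀ (n : ℕ) (A : Fin n → Set E), (∀ i, MeasurableSet (A i)) →
    Pairwise (fun i j => Disjoint (A i) (A j)) → iIndepFun (fun i ω => N ω (A i)) P

/-- The Euclidean plane. -/
abbrev Plane : Type := EuclideanSpace ℝ (Fin 2)

/-- The base stations `x i` form a homogeneous Poisson point process of density `lam` in the plane,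
and their power fading gains `g i` are i.i.d. exponential of mean `1` (Rayleigh fading) and
independent of the locations. -/
structure IsRayleighNetwork {Ω : Type*} [MeasurableSpace Ω] (P : Measure Ω) (lam : ℝ)
    (x : ℕ → Ω → Plane) (g : ℕ → Ω → ℝ) : Prop where
  measurable_location : ∀ i, Measurable (x i)
  measurable_gain : ∀ i, Measurable (g i)
  poisson : IsPoissonPointProcess P (ENNReal.ofReal lam • (volume : Measure Plane))
    (fun ω => Measure.sum fun i => Measure.dirac (x i ω))
  gain_law : ∀ i, HasLaw (g i) (expMeasure 1) P
  gain_indep : iIndepFun g P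
  location_gain_indep : IndepFun (fun ω i => x i ω) (fun ω i => g i ω) P

/-- The pathloss at horizontal distance `t` for base stations of height `h`. -/
def pathloss (α h t : ℝ) : ℝ := (t ^ 2 + h ^ 2) ^ (-(α / 2))

/-- The base station association policy. -/
inductive Association
  | closest
  | strongest

/-- Given a serving base station at horizontal distance `r`, the interfering ones are distributed as
the points of the Poisson process at horizontal distance at least `ν(r)`, with `ν(r) = r` for
closest and `ν(r) = 0` for strongest association. -/
def nu : Association → ℝ → ℝ
  | .closest, r => r
  | .strongest, _ => 0

open Classical in
/-- The aggregate interference power at the origin when the serving base station is at horizontal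
distance `r`. -/
def interference {Ω : Type*} (x : ℕ → Ω → Plane) (g : ℕ → Ω → ℝ) (α h : ℝ) (q : Association)
    (r : ℝ) (ω : Ω) : ℝ≥0∞ :=
  ∑' i, if nu q r ≤ ‖x i ω‖ then ENNReal.ofReal (g i ω * pathloss α h ‖x i ω‖) else 0

open Classical in
/-- The Laplace transform `E[exp(-s X)]` of a random variable with values in `[0, ∞]`, with the
convention that `exp(-s X) = 0` where `X = ∞` (for every `s`, so that the value at `s = 0` is
the probability that `X` is finite). -/
def laplaceTransform {Ω : Type*} [MeasurableSpace Ω] (P : Measure Ω) (X : Ω → ℝ≥0∞) (s : ℝ) : ℝ :=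
  ∫ ω, (if X ω = ∞ then 0 else Real.exp (-s * (X ω).toReal)) ∂P

/-- The integral expression of the Laplace transform of the interference with Rayleigh fading. -/
def laplaceIntegral (lam α h : ℝ) (q : Association) (r s : ℝ) : ℝ :=
  Real.exp (-2 * Real.pi * lam *
    ∫ t in Set.Ioi (nu q r), (1 - 1 / (1 + s * pathloss α h t)) * t)

/-- The closed form of the Laplace transform of the interference with non-elevated base stations:
`exp(-πλr²(η(s,1,r) - 1))` for closest and `exp(-2πλζ(1)s^(2/α))` for strongest association. -/
def laplaceNonElevated (lam α : ℝ) : Association → ℝ → ℝ → ℝ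
  | .closest, r, s => Real.exp (-Real.pi * lam * r ^ 2 * (eta α s 1 r - 1))
  | .strongest, _, s => Real.exp (-2 * Real.pi * lam * zeta α 1 * s ^ (2 / α))

end ElevatedBS

end

/-!
The probabilistic part is the Laplace functional of a Poisson point process with independent marks.
For a simple function of the points it is the product, over its values, of the Laplace transforms of
independent Poisson variables, and monotone approximation gives all nonnegative functions.
Conditionally on the points, the marks are integrated out by independence; since the Laplace
transform of an exponential variable of mean `1` is `b ↦ 1 / (1 + b)`, an interferer at distance `t`
contributes the factor `1 / (1 + s ℓ(t, h))`, and polar coordinates turn the exponent into an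
integral over `t ∈ (ν(r), ∞)`. For `s = 0` one lets `s → 0`.

The pathloss depends on `t² + h²` only, so `u² = t² + h²` turns the integral for elevated base
stations over `(ν, ∞)` into the one for non-elevated base stations over `(√(ν² + h²), ∞)`. After
`u = t ^ α` the latter is, up to a constant factor, the integral of `s u ^ (2 / α - 1) / (u + s)`
over a half-line: a Beta integral if the half-line starts at `0`, and otherwise, by scaling, Euler's
integral for `₂F₁(1, -2/α; 1 - 2/α; ·)`, which represents this function on the whole cut plane.
-/

noncomputable section

namespace ElevatedBS

open Filter Topology

/-! ### The exponential and the logarithm on `[0, ∞]` -/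

/-- The function `x ↦ exp (-x)` on `[0, ∞]`, with `exp (-∞) = 0`: Laplace transforms of
`[0, ∞]`-valued random variables are Lebesgue integrals of it, without finiteness conditions. -/
def expNeg (x : ℝ≥0∞) : ℝ≥0∞ := EReal.exp (-(x : EReal))

lemma continuous_expNeg : Continuous expNeg :=
  ENNReal.continuous_exp.comp (continuous_neg.comp continuous_coe_ennreal_ereal)

@[fun_prop]
lemma measurable_expNeg : Measurable expNeg := continuous_expNeg.measurable

lemma antitone_expNeg : Antitone expNeg := fun x y hxy => by
  rw [expNeg, expNeg, EReal.exp_le_exp_iff, EReal.neg_le_neg_iff]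
  exact_mod_cast hxy

@[simp] lemma expNeg_zero : expNeg 0 = 1 := by simp [expNeg]

@[simp] lemma expNeg_top : expNeg ∞ = 0 := by simp [expNeg]

lemma expNeg_le_one (x : ℝ≥0∞) : expNeg x ≤ 1 := expNeg_zero ▸ antitone_expNeg zero_le

lemma expNeg_ne_top (x : ℝ≥0∞) : expNeg x ≠ ∞ :=
  ne_top_of_le_ne_top ENNReal.one_ne_top (expNeg_le_one x)

lemma expNeg_ofReal {x : ℝ} (hx : 0 ≤ x) :
    expNeg (ENNReal.ofReal x) = ENNReal.ofReal (Real.exp (-x)) := by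
  rw [expNeg, EReal.coe_ennreal_ofReal, max_eq_left hx, ← EReal.coe_neg, EReal.exp_coe]

lemma toReal_expNeg {x : ℝ≥0∞} (hx : x ≠ ∞) : (expNeg x).toReal = Real.exp (-x.toReal) := by
  rw [← ENNReal.toReal_ofReal (Real.exp_nonneg _), ← expNeg_ofReal ENNReal.toReal_nonneg,
    ENNReal.ofReal_toReal hx]

lemma expNeg_add (x y : ℝ≥0∞) : expNeg (x + y) = expNeg x * expNeg y := by
  rw [expNeg, EReal.coe_ennreal_add, EReal.neg_add (by simp) (by simp), sub_eq_add_neg,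
    EReal.exp_add, expNeg, expNeg]

lemma expNeg_sum {ι : Type*} (t : Finset ι) (f : ι → ℝ≥0∞) :
    expNeg (∑ i ∈ t, f i) = ∏ i ∈ t, expNeg (f i) := by
  induction t using Finset.cons_induction with
  | empty => simp
  | cons a t ha ih => rw [Finset.sum_cons, Finset.prod_cons, expNeg_add, ih]

lemma expNeg_mul_natCast (x : ℝ≥0∞) (n : ℕ) : expNeg (x * n) = expNeg x ^ n := by
  simpa [mul_comm x] using expNeg_sum (Finset.range n) fun _ => x

lemma tendsto_expNeg_sum_range (f : ℕ → ℝ≥0∞) :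
    Tendsto (fun n => expNeg (∑ i ∈ Finset.range n, f i)) atTop (𝓝 (expNeg (∑' i, f i))) :=
  (continuous_expNeg.tendsto _).comp (ENNReal.tendsto_nat_tsum f)

/-- The function `a ↦ -log a` on `[0, ∞]`, cut off at `0`: on `[0, 1]` it is the inverse of
`expNeg`. -/
def negLog (a : ℝ≥0∞) : ℝ≥0∞ := (-ENNReal.log a).toENNReal

@[fun_prop]
lemma measurable_negLog : Measurable negLog := by
  unfold negLog
  fun_prop

lemma expNeg_negLog {a : ℝ≥0∞} (ha : a ≤ 1) : expNeg (negLog a) = a := by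
  have : 0 ≤ -ENNReal.log a := by
    rw [EReal.le_neg, neg_zero]; exact ENNReal.log_le_zero_iff.2 ha
  rw [expNeg, negLog, EReal.coe_toENNReal this, neg_neg, ENNReal.exp_log]

lemma tendsto_lintegral_expNeg {Ω : Type*} [MeasurableSpace Ω] {P : Measure Ω} [IsFiniteMeasure P]
    {X : ℕ → Ω → ℝ≥0∞} {Y : Ω → ℝ≥0∞} (hX : ∀ n, Measurable (X n))
    (hlim : ∀ ω, Tendsto (fun n => X n ω) atTop (𝓝 (Y ω))) :
    Tendsto (fun n => ∫⁻ ω, expNeg (X n ω) ∂P) atTop (𝓝 (∫⁻ ω, expNeg (Y ω) ∂P)) :=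
  tendsto_lintegral_of_dominated_convergence 1 (fun n => measurable_expNeg.comp (hX n))
    (fun _ => .of_forall fun _ => expNeg_le_one _) (by simp)
    (.of_forall fun ω => (continuous_expNeg.tendsto _).comp (hlim ω))

/-! ### Laplace functionals of Poisson point processes -/

lemma pow_mul_poissonMeasure_singleton (q m : ℝ≥0) (n : ℕ) :
    (q : ℝ≥0∞) ^ n * poissonMeasure m {n}
      = ENNReal.ofReal (Real.exp ((q - 1) * m)) * poissonMeasure (q * m) {n} := by
  rw [poissonMeasure_singleton, poissonMeasure_singleton, ← ENNReal.ofReal_coe_nnreal,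
    ← ENNReal.ofReal_pow q.coe_nonneg, ← ENNReal.ofReal_mul (by positivity),
    ← ENNReal.ofReal_mul (by positivity),
    show -(m : ℝ) = (q - 1) * m + -(q * m : ℝ≥0) by push_cast; ring, Real.exp_add]
  push_cast
  ring_nf

lemma lintegral_pow_poissonMeasure {q : ℝ≥0} (hq : q ≤ 1) (m : ℝ≥0) :
    ∫⁻ n, (q : ℝ≥0∞) ^ n ∂poissonMeasure m = expNeg ((1 - q) * m) := by
  have hqm : (1 - (q : ℝ≥0∞)) * m = ENNReal.ofReal ((1 - q) * m) := by
    rw [ENNReal.ofReal_mul (sub_nonneg.2 (mod_cast hq)), ENNReal.ofReal_sub _ q.coe_nonneg]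
    simp
  have hmass : ∑' n, poissonMeasure (q * m) {n} = 1 := by
    simpa using (lintegral_countable' (μ := poissonMeasure (q * m)) 1).symm
  rw [lintegral_countable']
  simp_rw [pow_mul_poissonMeasure_singleton]
  rw [ENNReal.tsum_mul_left, hmass, mul_one, hqm,
    expNeg_ofReal (mul_nonneg (sub_nonneg.2 (mod_cast hq)) m.coe_nonneg), ← neg_mul, neg_sub]

lemma lintegral_expNeg_mul_poissonMeasure (m : ℝ≥0) (c : ℝ≥0∞) :
    ∫⁻ n, expNeg (c * (n : ℕ)) ∂poissonMeasure m = expNeg ((1 - expNeg c) * m) := by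
  obtain ⟨q, hq⟩ : ∃ q : ℝ≥0, (q : ℝ≥0∞) = expNeg c :=
    ⟨_, ENNReal.coe_toNNReal (expNeg_ne_top c)⟩
  simp_rw [expNeg_mul_natCast, ← hq]
  exact lintegral_pow_poissonMeasure (by exact_mod_cast hq.trans_le (expNeg_le_one c)) m

namespace IsPoissonPointProcess

variable {Ω E : Type*} [MeasurableSpace Ω] [MeasurableSpace E] {P : Measure Ω} {μ : Measure E}
  {N : Ω → Measure E}

lemma isProbabilityMeasure (hN : IsPoissonPointProcess P μ N) : IsProbabilityMeasure P :=
  (hN.indep 0 Fin.elim0 (fun i => i.elim0) fun i => i.elim0).isProbabilityMeasure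

lemma measurable_apply (hN : IsPoissonPointProcess P μ N) {A : Set E} (hA : MeasurableSet A) :
    Measurable fun ω => N ω A :=
  (Measure.measurable_coe hA).comp hN.measurable

lemma iIndepFun_apply {ι : Type*} [Finite ι] (hN : IsPoissonPointProcess P μ N) {A : ι → Set E}
    (hA : ∀ i, MeasurableSet (A i)) (hdisj : Pairwise fun i j => Disjoint (A i) (A j)) :
    iIndepFun (fun i ω => N ω (A i)) P := by
  let e := Finite.equivFin ι
  have h := hN.indep _ (A ∘ e.symm) (fun i => hA _) fun i j hij => hdisj (e.symm.injective.ne hij)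
  simpa using h.precomp e.injective

lemma lintegral_expNeg_mul_apply (hN : IsPoissonPointProcess P μ N) {A : Set E}
    (hA : MeasurableSet A) (hμ : μ A ≠ ∞) (c : ℝ≥0∞) :
    ∫⁻ ω, expNeg (c * N ω A) ∂P = expNeg ((1 - expNeg c) * μ A) := by
  rw [(hN.law A hA hμ).lintegral_comp (f := fun y => expNeg (c * y)) (by fun_prop),
    lintegral_map (by fun_prop) (by fun_prop), lintegral_expNeg_mul_poissonMeasure,
    ENNReal.coe_toNNReal hμ]

lemma lintegral_expNeg_lintegral_simpleFunc (hN : IsPoissonPointProcess P μ N)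
    (f : SimpleFunc E ℝ≥0∞) (hf : ∀ c ≠ 0, μ (f ⁻¹' {c}) ≠ ∞) :
    ∫⁻ ω, expNeg (∫⁻ y, f y ∂N ω) ∂P = expNeg (∫⁻ y, (1 - expNeg (f y)) ∂μ) := by
  have := hN.isProbabilityMeasure
  have hfib : ∀ c, MeasurableSet (f ⁻¹' {c}) := f.measurableSet_fiber
  have hind : iIndepFun (fun (c : f.range) ω => expNeg (c * N ω (f ⁻¹' {c.1}))) P :=
    (hN.iIndepFun_apply (fun c : f.range => hfib c) fun c d hcd =>
      Disjoint.preimage _ (Set.disjoint_singleton.2 (Subtype.coe_ne_coe.2 hcd))).comp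
        (fun c y => expNeg (c * y)) fun c => by fun_prop
  have hleft : ∀ ω, expNeg (∫⁻ y, f y ∂N ω)
      = ∏ c : f.range, expNeg (c * N ω (f ⁻¹' {c.1})) := fun ω => by
    rw [SimpleFunc.lintegral_eq_lintegral, SimpleFunc.lintegral, expNeg_sum,
      Finset.prod_coe_sort f.range fun c => expNeg (c * N ω (f ⁻¹' {c}))]
  have hright : ∫⁻ y, (1 - expNeg (f y)) ∂μ
      = ∑ c ∈ f.range, (1 - expNeg c) * μ (f ⁻¹' {c}) := by
    rw [← SimpleFunc.map_lintegral (fun c => 1 - expNeg c) f, ← SimpleFunc.lintegral_eq_lintegral]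
    rfl
  simp_rw [hleft]
  rw [lintegral_prod_eq_prod_lintegral_of_indepFun _ _ hind fun c =>
      measurable_expNeg.comp ((hN.measurable_apply (hfib c)).const_mul _),
    Finset.prod_coe_sort f.range fun c => ∫⁻ ω, expNeg (c * N ω (f ⁻¹' {c})) ∂P,
    hright, expNeg_sum]
  refine Finset.prod_congr rfl fun c _ => ?_
  rcases eq_or_ne c 0 with rfl | hc
  · simp
  · exact hN.lintegral_expNeg_mul_apply (hfib c) (hf c hc) c

end IsPoissonPointProcess

/-- The simple functions increasing to `f`, cut off to sets of finite measure so that each of their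
nonzero values is taken on a set of finite measure. -/
def finiteApprox {E : Type*} [MeasurableSpace E] (μ : Measure E) [SigmaFinite μ] (f : E → ℝ≥0∞)
    (n : ℕ) : SimpleFunc E ℝ≥0∞ :=
  (SimpleFunc.eapprox f n).restrict (spanningSets μ n)

section finiteApprox

variable {E : Type*} [MeasurableSpace E] (μ : Measure E) [SigmaFinite μ] (f : E → ℝ≥0∞)

lemma finiteApprox_apply (n : ℕ) (y : E) :
    finiteApprox μ f n y = (spanningSets μ n).indicator (SimpleFunc.eapprox f n) y :=
  SimpleFunc.restrict_apply _ (measurableSet_spanningSets μ n) y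

lemma monotone_finiteApprox (y : E) : Monotone fun n => finiteApprox μ f n y := fun m n hmn => by
  simp only [finiteApprox_apply]
  exact (Set.indicator_le_indicator_of_subset (monotone_spanningSets μ hmn)
    (fun _ => zero_le) y).trans
      (Set.indicator_le_indicator (SimpleFunc.monotone_eapprox f hmn y))

lemma tendsto_finiteApprox {f : E → ℝ≥0∞} (hf : Measurable f) (y : E) :
    Tendsto (fun n => finiteApprox μ f n y) atTop (𝓝 (f y)) := by
  refine (SimpleFunc.tendsto_eapprox hf y).congr' ?_
  filter_upwards [eventually_ge_atTop (spanningSetsIndex μ y)] with n hn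
  rw [finiteApprox_apply,
    Set.indicator_of_mem (monotone_spanningSets μ hn (mem_spanningSetsIndex μ y))]

lemma measure_finiteApprox_preimage_ne_top (n : ℕ) {c : ℝ≥0∞} (hc : c ≠ 0) :
    μ (finiteApprox μ f n ⁻¹' {c}) ≠ ∞ := by
  refine ((measure_mono fun y hy => ?_).trans_lt (measure_spanningSets_lt_top μ n)).ne
  by_contra hy'
  exact hc (by rw [← (show finiteApprox μ f n y = c from hy), finiteApprox_apply,
    Set.indicator_of_notMem hy'])

end finiteApprox

theorem IsPoissonPointProcess.lintegral_expNeg_lintegral {Ω E : Type*} [MeasurableSpace Ω]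
    [MeasurableSpace E] {P : Measure Ω} {μ : Measure E} {N : Ω → Measure E} [SigmaFinite μ]
    (hN : IsPoissonPointProcess P μ N) {f : E → ℝ≥0∞} (hf : Measurable f) :
    ∫⁻ ω, expNeg (∫⁻ y, f y ∂N ω) ∂P = expNeg (∫⁻ y, (1 - expNeg (f y)) ∂μ) := by
  have := hN.isProbabilityMeasure
  have hcont : Continuous fun x => 1 - expNeg x :=
    (ENNReal.continuous_sub_left ENNReal.one_ne_top).comp continuous_expNeg
  have hleft : Tendsto (fun n => ∫⁻ ω, expNeg (∫⁻ y, finiteApprox μ f n y ∂N ω) ∂P) atTop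
      (𝓝 (∫⁻ ω, expNeg (∫⁻ y, f y ∂N ω) ∂P)) :=
    tendsto_lintegral_expNeg
      (fun n => (Measure.measurable_lintegral (finiteApprox μ f n).measurable).comp hN.measurable)
      fun ω => lintegral_tendsto_of_tendsto_of_monotone
        (fun n => (finiteApprox μ f n).aemeasurable) (.of_forall (monotone_finiteApprox μ f))
        (.of_forall (tendsto_finiteApprox μ hf))
  have hright : Tendsto (fun n => ∫⁻ y, (1 - expNeg (finiteApprox μ f n y)) ∂μ) atTop
      (𝓝 (∫⁻ y, (1 - expNeg (f y)) ∂μ)) :=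
    lintegral_tendsto_of_tendsto_of_monotone
      (fun n => (hcont.measurable.comp (finiteApprox μ f n).measurable).aemeasurable)
      (.of_forall fun y m n hmn =>
        tsub_le_tsub_left (antitone_expNeg (monotone_finiteApprox μ f y hmn)) _)
      (.of_forall fun y => (hcont.tendsto _).comp (tendsto_finiteApprox μ hf y))
  refine tendsto_nhds_unique hleft (((continuous_expNeg.tendsto _).comp hright).congr fun n => ?_)
  exact (hN.lintegral_expNeg_lintegral_simpleFunc _ fun c hc =>
    measure_finiteApprox_preimage_ne_top μ f n hc).symm

section Independence

variable {Ω : Type*} [MeasurableSpace Ω] {P : Measure Ω}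

lemma lintegral_expNeg_tsum_of_iIndepFun {F : ℕ → Ω → ℝ≥0∞} (hF : ∀ i, Measurable (F i))
    (hind : iIndepFun F P) :
    ∫⁻ ω, expNeg (∑' i, F i ω) ∂P = expNeg (∑' i, negLog (∫⁻ ω, expNeg (F i ω) ∂P)) := by
  have := hind.isProbabilityMeasure
  have hle : ∀ i, ∫⁻ ω, expNeg (F i ω) ∂P ≤ 1 := fun i => by
    simpa using lintegral_mono (μ := P) fun ω => expNeg_le_one (F i ω)
  have hfin : ∀ n, ∫⁻ ω, expNeg (∑ i ∈ Finset.range n, F i ω) ∂P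
      = expNeg (∑ i ∈ Finset.range n, negLog (∫⁻ ω, expNeg (F i ω) ∂P)) := fun n => by
    simp_rw [expNeg_sum, expNeg_negLog (hle _)]
    exact lintegral_prod_eq_prod_lintegral_of_indepFun _ _
      (hind.comp (fun _ => expNeg) fun _ => measurable_expNeg)
      fun i => measurable_expNeg.comp (hF i)
  have hlim := tendsto_lintegral_expNeg (P := P)
    (fun n => Finset.measurable_fun_sum (Finset.range n) fun i _ => hF i)
    fun ω => ENNReal.tendsto_nat_tsum fun i => F i ω
  exact tendsto_nhds_unique hlim ((tendsto_expNeg_sum_range _).congr fun n => (hfin n).symm)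

lemma lintegral_comp_prodMk_of_indepFun {A B : Type*} [MeasurableSpace A] [MeasurableSpace B]
    [IsFiniteMeasure P] {X : Ω → A} {Y : Ω → B} (hX : Measurable X) (hY : Measurable Y)
    (hind : IndepFun X Y P) {Φ : A × B → ℝ≥0∞} (hΦ : Measurable Φ) :
    ∫⁻ ω, Φ (X ω, Y ω) ∂P = ∫⁻ ω, ∫⁻ ω', Φ (X ω, Y ω') ∂P ∂P := by
  calc ∫⁻ ω, Φ (X ω, Y ω) ∂P = ∫⁻ p, Φ p ∂((P.map X).prod (P.map Y)) := by
        rw [← hind.map_prod_eq_prod_map_map hX.aemeasurable hY.aemeasurable,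
          lintegral_map hΦ (hX.prodMk hY)]
    _ = ∫⁻ ω, ∫⁻ b, Φ (X ω, b) ∂P.map Y ∂P := by
        rw [lintegral_prod _ hΦ.aemeasurable, lintegral_map hΦ.lintegral_prod_right' hX]
    _ = ∫⁻ ω, ∫⁻ ω', Φ (X ω, Y ω') ∂P ∂P :=
        lintegral_congr fun ω => lintegral_map (hΦ.comp measurable_prodMk_left) hY

end Independence

/-- Conditionally on the points, the marks only enter through the Laplace transform of `f (y, ·)`,
which leaves the Laplace functional of the unmarked process at its negative logarithm. -/
theorem IsPoissonPointProcess.lintegral_expNeg_tsum_marked {Ω E M : Type*} [MeasurableSpace Ω]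
    [MeasurableSpace E] [MeasurableSpace M] {P : Measure Ω} {μ : Measure E} [SigmaFinite μ]
    {ν : Measure M} {x : ℕ → Ω → E} {g : ℕ → Ω → M}
    (hN : IsPoissonPointProcess P μ fun ω => Measure.sum fun i => Measure.dirac (x i ω))
    (hx : ∀ i, Measurable (x i)) (hg : ∀ i, Measurable (g i)) (hlaw : ∀ i, HasLaw (g i) ν P)
    (hgind : iIndepFun g P) (hxg : IndepFun (fun ω i => x i ω) (fun ω i => g i ω) P)
    {f : E × M → ℝ≥0∞} (hf : Measurable f) :
    ∫⁻ ω, expNeg (∑' i, f (x i ω, g i ω)) ∂P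
      = expNeg (∫⁻ y, (1 - ∫⁻ m, expNeg (f (y, m)) ∂ν) ∂μ) := by
  have := hgind.isProbabilityMeasure
  have : IsProbabilityMeasure ν := (hlaw 0).isProbabilityMeasure_iff.1 ‹_›
  let L : E → ℝ≥0∞ := fun y => ∫⁻ m, expNeg (f (y, m)) ∂ν
  have hL : Measurable L := (measurable_expNeg.comp hf).lintegral_prod_right'
  have hlogL : Measurable fun y => negLog (L y) := measurable_negLog.comp hL
  have hL1 : ∀ y, L y ≤ 1 := fun y => by
    simpa using lintegral_mono (μ := ν) fun m => expNeg_le_one (f (y, m))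
  have hmarks : ∀ ω, ∫⁻ ω', expNeg (∑' i, f (x i ω, g i ω')) ∂P
      = expNeg (∫⁻ y, negLog (L y) ∂Measure.sum fun i => Measure.dirac (x i ω)) := fun ω => by
    have hfx : ∀ i, Measurable fun m => f (x i ω, m) := fun i => hf.comp measurable_prodMk_left
    rw [lintegral_expNeg_tsum_of_iIndepFun (F := fun i ω' => f (x i ω, g i ω'))
      (fun i => (hfx i).comp (hg i)) (hgind.comp _ hfx), lintegral_sum_measure]
    congr! 3 with i
    rw [lintegral_dirac' _ hlogL]
    exact congr_arg negLog ((hlaw i).lintegral_comp (measurable_expNeg.comp (hfx i)).aemeasurable)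
  have hΦ : Measurable fun p : (ℕ → E) × (ℕ → M) => expNeg (∑' i, f (p.1 i, p.2 i)) := by
    fun_prop
  rw [lintegral_comp_prodMk_of_indepFun (measurable_pi_lambda _ hx) (measurable_pi_lambda _ hg)
    hxg hΦ]
  simp_rw [hmarks]
  rw [hN.lintegral_expNeg_lintegral hlogL]
  simp_rw [expNeg_negLog (hL1 _), L]

lemma exponentialPDF_mul_expNeg {r b : ℝ} (hr : 0 < r) (hb : 0 ≤ b) (y : ℝ) :
    exponentialPDF r y * expNeg (ENNReal.ofReal (y * b))
      = ENNReal.ofReal (r / (r + b)) * exponentialPDF (r + b) y := by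
  rcases lt_or_ge y 0 with hy | hy
  · simp [exponentialPDF_of_neg hy]
  · rw [exponentialPDF_of_nonneg hy, exponentialPDF_of_nonneg hy,
      expNeg_ofReal (mul_nonneg hy hb), ← ENNReal.ofReal_mul (by positivity),
      ← ENNReal.ofReal_mul (by positivity), mul_assoc, ← Real.exp_add, ← mul_assoc,
      div_mul_cancel₀ r (by positivity)]
    ring_nf

lemma lintegral_expNeg_mul_expMeasure {r b : ℝ} (hr : 0 < r) (hb : 0 ≤ b) :
    ∫⁻ y, expNeg (ENNReal.ofReal (y * b)) ∂expMeasure r = ENNReal.ofReal (r / (r + b)) := by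
  have hmeas : ∀ r, Measurable (exponentialPDF r) := fun r =>
    (measurable_exponentialPDFReal r).ennreal_ofReal
  change ∫⁻ y, _ ∂volume.withDensity (exponentialPDF r) = _
  rw [lintegral_withDensity_eq_lintegral_mul _ (hmeas r) (by fun_prop)]
  simp_rw [Pi.mul_apply, exponentialPDF_mul_expNeg hr hb]
  rw [lintegral_const_mul _ (hmeas _), lintegral_exponentialPDF_eq_one (by positivity), mul_one]

lemma IsRayleighNetwork.lintegral_expNeg_tsum {Ω : Type*} [MeasurableSpace Ω] {P : Measure Ω}
    {lam : ℝ} {x : ℕ → Ω → Plane} {g : ℕ → Ω → ℝ} (hnet : IsRayleighNetwork P lam x g)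
    {b : Plane → ℝ} (hbm : Measurable b) (hb : ∀ y, 0 ≤ b y) :
    ∫⁻ ω, expNeg (∑' i, ENNReal.ofReal (g i ω * b (x i ω))) ∂P
      = expNeg (ENNReal.ofReal lam * ∫⁻ y, ENNReal.ofReal (1 - 1 / (1 + b y))) := by
  have : SigmaFinite (ENNReal.ofReal lam • (volume : Measure Plane)) :=
    inferInstanceAs (SigmaFinite (lam.toNNReal • (volume : Measure Plane)))
  rw [hnet.poisson.lintegral_expNeg_tsum_marked (f := fun p => ENNReal.ofReal (p.2 * b p.1))
    hnet.measurable_location hnet.measurable_gain hnet.gain_law hnet.gain_indep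
    hnet.location_gain_indep (by fun_prop), lintegral_smul_measure, smul_eq_mul]
  refine congr_arg (fun I => expNeg (ENNReal.ofReal lam * I)) (lintegral_congr fun y => ?_)
  rw [lintegral_expNeg_mul_expMeasure one_pos (hb y), ← ENNReal.ofReal_one,
    ← ENNReal.ofReal_sub _ (by have := hb y; positivity)]

/-! ### The radial integrals -/

lemma pathloss_nonneg (α h t : ℝ) : 0 ≤ pathloss α h t :=
  Real.rpow_nonneg (by positivity) _

lemma measurable_pathloss (α h : ℝ) : Measurable (pathloss α h) := by
  unfold pathloss
  fun_prop

lemma pathloss_zero_height (α : ℝ) {t : ℝ} (ht : 0 ≤ t) : pathloss α 0 t = t ^ (-α) := by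
  rw [pathloss, zero_pow two_ne_zero, add_zero, ← Real.rpow_two, ← Real.rpow_mul ht]
  congr 1
  ring

lemma pathloss_le_pathloss_zero_height {α t : ℝ} (h : ℝ) (hα : 0 ≤ α) (ht : 0 < t) :
    pathloss α h t ≤ pathloss α 0 t :=
  Real.rpow_le_rpow_of_nonpos (by positivity) (by nlinarith [sq_nonneg h]) (by linarith)

/-- The mean relative loss `1 - 𝔼[exp(-s g ℓ(t, h))]` caused by one interfering base station at
horizontal distance `t`, with the weight `t` of polar coordinates: the integrand of
`laplaceIntegral`. -/
def radialLoss (α h s t : ℝ) : ℝ := (1 - 1 / (1 + s * pathloss α h t)) * t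

lemma measurable_radialLoss (α h s : ℝ) : Measurable (radialLoss α h s) := by
  have := measurable_pathloss α h
  unfold radialLoss
  fun_prop

lemma radialLoss_nonneg (α h : ℝ) {s t : ℝ} (hs : 0 ≤ s) (ht : 0 ≤ t) :
    0 ≤ radialLoss α h s t := by
  have hloss := mul_nonneg hs (pathloss_nonneg α h t)
  refine mul_nonneg (sub_nonneg.2 ?_) ht
  exact div_le_one_of_le₀ (by linarith) (by linarith)

lemma radialLoss_le_radialLoss_zero_height {α s s' t : ℝ} (h : ℝ) (hα : 0 ≤ α) (hs : 0 ≤ s)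
    (hss' : s ≤ s') (ht : 0 < t) : radialLoss α h s t ≤ radialLoss α 0 s' t := by
  have hnonneg := mul_nonneg hs (pathloss_nonneg α h t)
  have hle : s * pathloss α h t ≤ s' * pathloss α 0 t :=
    mul_le_mul hss' (pathloss_le_pathloss_zero_height h hα ht) (pathloss_nonneg α h t)
      (hs.trans hss')
  unfold radialLoss
  gcongr

lemma continuousOn_radialLoss_laplace_variable (α h t : ℝ) :
    ContinuousOn (fun s => radialLoss α h s t) (Set.Ici 0) := by
  have hne : ∀ s ∈ Set.Ici (0 : ℝ), 1 + s * pathloss α h t ≠ 0 := fun s hs =>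
    (add_pos_of_pos_of_nonneg one_pos (mul_nonneg hs (pathloss_nonneg α h t))).ne'
  unfold radialLoss
  fun_prop (disch := assumption)

lemma radialLoss_zero_height_eq {α s t : ℝ} (hα : 2 < α) (hs : 0 ≤ s) (ht : 0 < t) :
    radialLoss α 0 s t
      = 1 / α * (α * t ^ (α - 1) * Real.rpowIntegrand₀₁ (2 / α) (t ^ α) s) := by
  have htα : 0 < t ^ α := Real.rpow_pos_of_pos ht α
  have hd : 2 / α ∈ Set.Ioo (0 : ℝ) 1 := ⟨by positivity, (div_lt_one (by linarith)).2 hα⟩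
  have hpow : t ^ (α - 1) * (t ^ α) ^ (2 / α - 1) = t := by
    rw [← Real.rpow_mul ht.le, ← Real.rpow_add ht]
    convert Real.rpow_one t using 2
    field_simp
    ring
  have hcancel : 1 - 1 / (1 + s * t ^ (-α)) = s / (t ^ α + s) := by
    rw [Real.rpow_neg ht.le]
    field_simp
    ring
  rw [Real.rpowIntegrand₀₁_eq_pow_div hd htα.le hs, radialLoss, pathloss_zero_height α ht.le,
    hcancel]
  nth_rw 2 [← hpow]
  field_simp

lemma integrableOn_radialLoss_zero_height {α s : ℝ} (hα : 2 < α) (hs : 0 ≤ s) :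
    IntegrableOn (radialLoss α 0 s) (Set.Ioi 0) := by
  have hd : 2 / α ∈ Set.Ioo (0 : ℝ) 1 := ⟨by positivity, (div_lt_one (by linarith)).2 hα⟩
  have hint := ((integrableOn_Ioi_comp_rpow_iff _ (by linarith : α ≠ 0)).2
    (Real.integrableOn_rpowIntegrand₀₁_Ioi hd hs)).const_mul (1 / α)
  refine IntegrableOn.congr_fun hint (fun t ht => ?_) measurableSet_Ioi
  rw [radialLoss_zero_height_eq hα hs ht, abs_of_pos (by linarith), smul_eq_mul]

lemma integrableOn_radialLoss {α s : ℝ} (h : ℝ) (hα : 2 < α) (hs : 0 ≤ s) :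
    IntegrableOn (radialLoss α h s) (Set.Ioi 0) := by
  refine (integrableOn_radialLoss_zero_height hα hs).mono'
    (measurable_radialLoss α h s).aestronglyMeasurable ?_
  filter_upwards [ae_restrict_mem measurableSet_Ioi] with t ht
  rw [Real.norm_of_nonneg (radialLoss_nonneg α h hs (le_of_lt ht))]
  exact radialLoss_le_radialLoss_zero_height h (by linarith) hs le_rfl ht

lemma integral_Ioi_radialLoss_zero_height {α a s : ℝ} (hα : 2 < α) (ha : 0 ≤ a) (hs : 0 ≤ s) :
    ∫ t in Set.Ioi a, radialLoss α 0 s t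
      = 1 / α * ∫ u in Set.Ioi (a ^ α), Real.rpowIntegrand₀₁ (2 / α) u s := by
  rw [← integral_comp_rpow_Ioi_of_pos' (by linarith : 0 < α) (Real.rpow_nonneg ha α),
    Real.rpow_rpow_inv ha (by linarith), ← integral_const_mul]
  exact setIntegral_congr_fun measurableSet_Ioi fun t ht =>
    radialLoss_zero_height_eq hα hs (ha.trans_lt ht)

lemma integral_Ioi_comp_add_right {E : Type*} [NormedAddCommGroup E] [NormedSpace ℝ E]
    (f : ℝ → E) (a c : ℝ) : ∫ x in Set.Ioi a, f (x + c) = ∫ y in Set.Ioi (a + c), f y := by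
  have hpre := (measurePreserving_add_right volume c).setIntegral_preimage_emb
    (MeasurableEquiv.addRight c).measurableEmbedding f (Set.Ioi (a + c))
  rwa [Set.preimage_add_const_Ioi, add_sub_cancel_right] at hpre

lemma integral_Ioi_comp_sq_add_mul (f : ℝ → ℝ) {a : ℝ} (c : ℝ) (ha : 0 ≤ a) :
    ∫ t in Set.Ioi a, f (t ^ 2 + c) * t = 1 / 2 * ∫ y in Set.Ioi (a ^ 2 + c), f y := by
  rw [← integral_Ioi_comp_add_right, ← integral_comp_rpow_Ioi_of_pos' two_pos (sq_nonneg a),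
    ← one_div, ← Real.sqrt_eq_rpow, Real.sqrt_sq ha, ← integral_const_mul]
  refine setIntegral_congr_fun measurableSet_Ioi fun t _ => ?_
  norm_num
  ring

lemma integral_Ioi_radialLoss_eq_zero_height {α a : ℝ} (h s : ℝ) (ha : 0 ≤ a) :
    ∫ t in Set.Ioi a, radialLoss α h s t
      = ∫ t in Set.Ioi √(a ^ 2 + h ^ 2), radialLoss α 0 s t := by
  let f : ℝ → ℝ := fun y => 1 - 1 / (1 + s * y ^ (-(α / 2)))
  have hleft := integral_Ioi_comp_sq_add_mul f (h ^ 2) ha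
  have hright := integral_Ioi_comp_sq_add_mul f (0 ^ 2) (Real.sqrt_nonneg (a ^ 2 + h ^ 2))
  rw [Real.sq_sqrt (by positivity), zero_pow two_ne_zero, add_zero, ← hleft] at hright
  simpa only [radialLoss, pathloss, f, zero_pow two_ne_zero] using hright.symm

/-! ### The Laplace transform of the interference -/

section LaplaceTransform

variable {Ω : Type*} [MeasurableSpace Ω] {P : Measure Ω} {X : Ω → ℝ≥0∞}

lemma laplaceTransform_eq_toReal_lintegral_expNeg (hX : Measurable X) {s : ℝ} (hs : 0 < s) :
    laplaceTransform P X s = (∫⁻ ω, expNeg (ENNReal.ofReal s * X ω) ∂P).toReal := by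
  rw [← integral_toReal (by fun_prop)
    (.of_forall fun ω => (expNeg_le_one _).trans_lt ENNReal.one_lt_top)]
  refine integral_congr_ae (.of_forall fun ω => ?_)
  dsimp only
  split_ifs with hω
  · rw [hω, ENNReal.mul_top (by simpa using hs), expNeg_top, ENNReal.toReal_zero]
  · rw [toReal_expNeg (ENNReal.mul_ne_top ENNReal.ofReal_ne_top hω), ENNReal.toReal_mul,
      ENNReal.toReal_ofReal hs.le, neg_mul]

lemma continuousOn_laplaceTransform [IsFiniteMeasure P] (hX : Measurable X) :
    ContinuousOn (laplaceTransform P X) (Set.Ici 0) := by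
  classical
  refine continuousOn_of_dominated (bound := fun _ => 1) (fun s _ => ?_) (fun s hs => ?_)
    (integrable_const 1) (.of_forall fun ω => ?_)
  · exact (Measurable.ite (hX (measurableSet_singleton ∞)) measurable_const
      (by fun_prop)).aestronglyMeasurable
  · refine .of_forall fun ω => ?_
    split_ifs
    · simp
    · rw [Real.norm_of_nonneg (Real.exp_nonneg _), Real.exp_le_one_iff, neg_mul, neg_nonpos]
      exact mul_nonneg hs ENNReal.toReal_nonneg
  · split_ifs <;> fun_prop

end LaplaceTransform

lemma nu_nonneg (q : Association) {r : ℝ} (hr : 0 ≤ r) : 0 ≤ nu q r := by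
  cases q
  exacts [hr, le_rfl]

lemma continuousOn_laplaceIntegral (lam : ℝ) {α r : ℝ} (h : ℝ) (q : Association) (hα : 2 < α)
    (hr : 0 ≤ r) : ContinuousOn (laplaceIntegral lam α h q r) (Set.Ici 0) := by
  have hpos : ∀ t ∈ Set.Ioi (nu q r), 0 < t := fun t ht => (nu_nonneg q hr).trans_lt ht
  have hcont : ContinuousOn (fun s => ∫ t in Set.Ioi (nu q r), radialLoss α h s t)
      (Set.Ici 0) := fun s₀ hs₀ => by
    have hs₀' : (0 : ℝ) ≤ s₀ + 1 := by linarith [Set.mem_Ici.1 hs₀]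
    refine continuousWithinAt_of_dominated (bound := radialLoss α 0 (s₀ + 1))
      (.of_forall fun s => (measurable_radialLoss α h s).aestronglyMeasurable) ?_
      ((integrableOn_radialLoss_zero_height hα hs₀').mono_set
        (Set.Ioi_subset_Ioi (nu_nonneg q hr)))
      (.of_forall fun t => continuousOn_radialLoss_laplace_variable α h t s₀ hs₀)
    filter_upwards [self_mem_nhdsWithin, mem_nhdsWithin_of_mem_nhds (Iic_mem_nhds (lt_add_one s₀))]
      with s hs hs_le
    filter_upwards [ae_restrict_mem measurableSet_Ioi] with t ht
    rw [Real.norm_of_nonneg (radialLoss_nonneg α h hs (hpos t ht).le)]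
    exact radialLoss_le_radialLoss_zero_height h (by linarith) hs hs_le (hpos t ht)
  exact (hcont.const_smul (-2 * Real.pi * lam)).rexp

lemma integrable_indicator_Ici_comp_norm_plane {f : ℝ → ℝ} {a : ℝ}
    (hf : IntegrableOn (fun t => f t * t) (Set.Ioi a)) :
    Integrable fun y : Plane => (Set.Ici a).indicator f ‖y‖ := by
  rw [integrable_fun_norm_addHaar (volume : Measure Plane), finrank_euclideanSpace_fin]
  have hind : (fun t : ℝ => t ^ (2 - 1) • (Set.Ici a).indicator f t)
      = (Set.Ici a).indicator fun t => f t * t := by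
    ext t
    simp [Set.indicator_apply, mul_comm]
  rw [hind]
  exact (((integrableOn_Ici_iff_integrableOn_Ioi ..).2 hf).integrable_indicator
    measurableSet_Ici).integrableOn

lemma integral_indicator_Ici_comp_norm_plane (f : ℝ → ℝ) {a : ℝ} (ha : 0 ≤ a) :
    ∫ y : Plane, (Set.Ici a).indicator f ‖y‖ = 2 * Real.pi * ∫ t in Set.Ioi a, f t * t := by
  have hind : ∀ t : ℝ, t ^ (2 - 1) • (Set.Ici a).indicator f t
      = (Set.Ici a).indicator (fun t => f t * t) t := fun t => by
    simp [Set.indicator_apply, mul_comm]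
  have hball : (volume : Measure Plane).real (Metric.ball 0 1) = Real.pi := by
    simp [measureReal_def, Real.pi_nonneg]
  have hset : ∫ t in Set.Ioi 0, (Set.Ici a).indicator (fun t => f t * t) t
      = ∫ t in Set.Ioi a, f t * t := by
    rw [← integral_Ici_eq_integral_Ioi, setIntegral_indicator measurableSet_Ici,
      Set.inter_eq_right.2 (Set.Ici_subset_Ici.2 ha), integral_Ici_eq_integral_Ioi]
  rw [integral_fun_norm_addHaar (volume : Measure Plane), finrank_euclideanSpace_fin, hball]
  simp_rw [hind]
  rw [hset, two_nsmul, smul_eq_mul]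
  ring

lemma ofReal_mul_interference {Ω : Type*} (x : ℕ → Ω → Plane) (g : ℕ → Ω → ℝ) (α h : ℝ)
    (q : Association) (r : ℝ) {s : ℝ} (hs : 0 ≤ s) (ω : Ω) :
    ENNReal.ofReal s * interference x g α h q r ω
      = ∑' i, ENNReal.ofReal
          (g i ω * (Set.Ici (nu q r)).indicator (fun t => s * pathloss α h t) ‖x i ω‖) := by
  rw [interference, ← ENNReal.tsum_mul_left]
  refine tsum_congr fun i => ?_
  by_cases hi : nu q r ≤ ‖x i ω‖
  · rw [if_pos hi, Set.indicator_of_mem (Set.mem_Ici.2 hi), ← ENNReal.ofReal_mul hs,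
      mul_left_comm]
  · rw [if_neg hi, Set.indicator_of_notMem (mt Set.mem_Ici.1 hi), mul_zero, mul_zero,
      ENNReal.ofReal_zero]

namespace IsRayleighNetwork

variable {Ω : Type*} [MeasurableSpace Ω] {P : Measure Ω} {lam : ℝ}
  {x : ℕ → Ω → Plane} {g : ℕ → Ω → ℝ}

lemma measurable_interference (hnet : IsRayleighNetwork P lam x g) (α h : ℝ) (q : Association)
    (r : ℝ) : Measurable (interference x g α h q r) := by
  classical
  have := measurable_pathloss α h
  refine Measurable.tsum fun i => ?_
  have hx := hnet.measurable_location i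
  have hg := hnet.measurable_gain i
  exact Measurable.ite (measurableSet_le measurable_const hx.norm) (by fun_prop) measurable_const

theorem laplaceTransform_interference_of_pos
    (hnet : IsRayleighNetwork P lam x g) (hlam : 0 ≤ lam) {α r s : ℝ} (h : ℝ) (q : Association)
    (hα : 2 < α) (hr : 0 ≤ r) (hs : 0 < s) :
    laplaceTransform P (interference x g α h q r) s = laplaceIntegral lam α h q r s := by
  let b : Plane → ℝ := fun y =>
    (Set.Ici (nu q r)).indicator (fun t => s * pathloss α h t) ‖y‖
  let f : ℝ → ℝ := fun t => 1 - 1 / (1 + s * pathloss α h t)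
  have hb_meas : Measurable b :=
    ((measurable_pathloss α h).const_mul s |>.indicator measurableSet_Ici).comp measurable_norm
  have hb_nonneg : ∀ y, 0 ≤ b y := fun y =>
    Set.indicator_nonneg (fun t _ => mul_nonneg hs.le (pathloss_nonneg α h t)) _
  have hloss : ∀ y, 1 - 1 / (1 + b y) = (Set.Ici (nu q r)).indicator f ‖y‖ := fun y => by
    by_cases hy : ‖y‖ ∈ Set.Ici (nu q r) <;> simp [b, f, hy]
  have hloss_nonneg : ∀ y, 0 ≤ 1 - 1 / (1 + b y) := fun y =>
    sub_nonneg.2 (div_le_one_of_le₀ (by linarith [hb_nonneg y]) (by linarith [hb_nonneg y]))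
  have hloss_int : Integrable fun y => 1 - 1 / (1 + b y) := by
    simp_rw [hloss]
    exact integrable_indicator_Ici_comp_norm_plane ((integrableOn_radialLoss h hα hs.le).mono_set
      (Set.Ioi_subset_Ioi (nu_nonneg q hr)))
  rw [laplaceTransform_eq_toReal_lintegral_expNeg (hnet.measurable_interference α h q r) hs]
  simp_rw [ofReal_mul_interference x g α h q r hs.le]
  rw [hnet.lintegral_expNeg_tsum hb_meas hb_nonneg,
    ← ofReal_integral_eq_lintegral_ofReal hloss_int (.of_forall hloss_nonneg),
    ← ENNReal.ofReal_mul hlam, toReal_expNeg ENNReal.ofReal_ne_top,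
    ENNReal.toReal_ofReal (mul_nonneg hlam (integral_nonneg hloss_nonneg)),
    integral_congr_ae (.of_forall hloss),
    integral_indicator_Ici_comp_norm_plane f (nu_nonneg q hr), laplaceIntegral]
  congr 1
  ring

-- At `s = 0` the formula says that the interference is almost surely finite. It follows by
-- continuity from `s > 0`, since `exp(-s I)` vanishes for every `s > 0` where `I = ∞`.
theorem laplaceTransform_interference
    (hnet : IsRayleighNetwork P lam x g) (hlam : 0 ≤ lam) {α r s : ℝ} (h : ℝ) (q : Association)
    (hα : 2 < α) (hr : 0 ≤ r) (hs : 0 ≤ s) :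
    laplaceTransform P (interference x g α h q r) s = laplaceIntegral lam α h q r s :=
  have := hnet.poisson.isProbabilityMeasure
  Set.EqOn.of_subset_closure
    (fun _ => hnet.laplaceTransform_interference_of_pos hlam h q hα hr)
    (continuousOn_laplaceTransform (hnet.measurable_interference α h q r))
    (continuousOn_laplaceIntegral lam h q hα hr) Set.Ioi_subset_Ici_self
    (closure_Ioi (0 : ℝ)).ge hs

end IsRayleighNetwork

/-! ### The Beta integral over the half-line -/

lemma lintegral_rpow_mul_exp_neg_mul_Ioi {a r : ℝ} (ha : 0 < a) (hr : 0 < r) :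
    ∫⁻ t in Set.Ioi 0, ENNReal.ofReal (t ^ (a - 1) * Real.exp (-(r * t)))
      = ENNReal.ofReal ((1 / r) ^ a * Real.Gamma a) := by
  have hval := Real.integral_rpow_mul_exp_neg_mul_Ioi ha hr
  have hpos : 0 < (1 / r) ^ a * Real.Gamma a :=
    mul_pos (Real.rpow_pos_of_pos (by positivity) _) (Real.Gamma_pos_of_pos ha)
  rw [← hval, ofReal_integral_eq_lintegral_ofReal (.of_integral_ne_zero (hval ▸ hpos.ne'))]
  filter_upwards [ae_restrict_mem measurableSet_Ioi] with t ht
  exact mul_nonneg (Real.rpow_nonneg (le_of_lt ht) _) (Real.exp_nonneg _)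

lemma lintegral_rpow_mul_rpow_mul_exp_neg_one_add_mul {a y : ℝ} (c : ℝ) (ha : 0 < a)
    (hy : 0 < y) :
    ∫⁻ v in Set.Ioi 0, ENNReal.ofReal (v ^ (a - 1)) *
        ENNReal.ofReal (y ^ (c - 1) * Real.exp (-((1 + v) * y)))
      = ENNReal.ofReal (Real.Gamma a) *
        ENNReal.ofReal (y ^ (c - a - 1) * Real.exp (-(1 * y))) := by
  have hsplit : ∀ v ∈ Set.Ioi (0 : ℝ), ENNReal.ofReal (v ^ (a - 1)) *
        ENNReal.ofReal (y ^ (c - 1) * Real.exp (-((1 + v) * y)))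
      = ENNReal.ofReal (y ^ (c - 1) * Real.exp (-y)) *
        ENNReal.ofReal (v ^ (a - 1) * Real.exp (-(y * v))) := fun v hv => by
    rw [← ENNReal.ofReal_mul (Real.rpow_nonneg (le_of_lt hv) _),
      ← ENNReal.ofReal_mul (by positivity), show -((1 + v) * y) = -y + -(y * v) by ring,
      Real.exp_add]
    congr 1
    ring
  have hpow : y ^ (c - 1) * (1 / y) ^ a = y ^ (c - a - 1) := by
    rw [one_div, Real.inv_rpow hy.le, ← Real.rpow_neg hy.le, ← Real.rpow_add hy]
    congr 1
    ring
  rw [setLIntegral_congr_fun measurableSet_Ioi hsplit, lintegral_const_mul _ (by fun_prop),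
    lintegral_rpow_mul_exp_neg_mul_Ioi ha hy, ← ENNReal.ofReal_mul (by positivity),
    ← ENNReal.ofReal_mul (Real.Gamma_pos_of_pos ha).le, ← hpow, one_mul]
  congr 1
  ring

-- Both sides are `∫∫ v ^ (a - 1) * y ^ (a + b - 1) * exp (-(1 + v) * y)` over the quadrant, with
-- the integrations carried out in either order.
lemma Gamma_mul_lintegral_rpow_div_one_add_rpow {a b : ℝ} (ha : 0 < a) (hb : 0 < b) :
    ENNReal.ofReal (Real.Gamma (a + b)) *
        ∫⁻ v in Set.Ioi 0, ENNReal.ofReal (v ^ (a - 1) / (1 + v) ^ (a + b))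
      = ENNReal.ofReal (Real.Gamma a * Real.Gamma b) := by
  have hinner_y : ∀ v ∈ Set.Ioi (0 : ℝ),
      ENNReal.ofReal (Real.Gamma (a + b)) * ENNReal.ofReal (v ^ (a - 1) / (1 + v) ^ (a + b))
        = ∫⁻ y in Set.Ioi 0, ENNReal.ofReal (v ^ (a - 1)) *
            ENNReal.ofReal (y ^ (a + b - 1) * Real.exp (-((1 + v) * y))) := fun v hv => by
    have hv' : 0 < 1 + v := by linarith [Set.mem_Ioi.1 hv]
    rw [lintegral_const_mul _ (by fun_prop), lintegral_rpow_mul_exp_neg_mul_Ioi (by positivity) hv',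
      ← ENNReal.ofReal_mul (Real.Gamma_pos_of_pos (by positivity)).le,
      ← ENNReal.ofReal_mul (Real.rpow_nonneg (le_of_lt hv) _), one_div, Real.inv_rpow hv'.le]
    congr 1
    ring
  rw [← lintegral_const_mul _ (by fun_prop), setLIntegral_congr_fun measurableSet_Ioi hinner_y,
    lintegral_lintegral_swap (Measurable.aemeasurable (by fun_prop)),
    setLIntegral_congr_fun measurableSet_Ioi fun y hy =>
      lintegral_rpow_mul_rpow_mul_exp_neg_one_add_mul (a + b) ha hy,
    lintegral_const_mul _ (by fun_prop), add_sub_cancel_left,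
    lintegral_rpow_mul_exp_neg_mul_Ioi hb one_pos,
    ← ENNReal.ofReal_mul (Real.Gamma_pos_of_pos ha).le, div_one, Real.one_rpow, one_mul]

lemma integral_rpow_div_one_add_rpow {a b : ℝ} (ha : 0 < a) (hb : 0 < b) :
    ∫ v in Set.Ioi 0, v ^ (a - 1) / (1 + v) ^ (a + b)
      = Real.Gamma a * Real.Gamma b / Real.Gamma (a + b) := by
  have hΓ : 0 < Real.Gamma (a + b) := Real.Gamma_pos_of_pos (by positivity)
  have hnonneg : 0 ≤ᵐ[volume.restrict (Set.Ioi 0)]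
      fun v : ℝ => v ^ (a - 1) / (1 + v) ^ (a + b) := by
    filter_upwards [ae_restrict_mem measurableSet_Ioi] with v hv
    have hv' : 0 < v := hv
    exact (by positivity : 0 ≤ v ^ (a - 1) / (1 + v) ^ (a + b))
  have hval := congrArg ENNReal.toReal (Gamma_mul_lintegral_rpow_div_one_add_rpow ha hb)
  rw [ENNReal.toReal_mul, ENNReal.toReal_ofReal hΓ.le, ENNReal.toReal_ofReal
    (mul_pos (Real.Gamma_pos_of_pos ha) (Real.Gamma_pos_of_pos hb)).le] at hval
  rw [integral_eq_lintegral_of_nonneg_ae hnonneg (Measurable.aestronglyMeasurable (by fun_prop)),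
    ← hval, mul_div_cancel_left₀ _ hΓ.ne']

lemma integral_Ioi_rpowIntegrand₀₁_one {d : ℝ} (hd : d ∈ Set.Ioo (0 : ℝ) 1) :
    ∫ u in Set.Ioi 0, Real.rpowIntegrand₀₁ d u 1 = Real.Gamma d * Real.Gamma (1 - d) := by
  have hbeta := integral_rpow_div_one_add_rpow hd.1 (sub_pos.2 hd.2)
  rw [add_sub_cancel, Real.Gamma_one, div_one] at hbeta
  rw [← hbeta]
  refine setIntegral_congr_fun measurableSet_Ioi fun u hu => ?_
  rw [Real.rpowIntegrand₀₁_eq_pow_div hd (le_of_lt hu) zero_le_one, mul_one, Real.rpow_one,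
    add_comm u]

lemma integral_Ioi_zero_radialLoss_zero_height {α s : ℝ} (hα : 2 < α) (hs : 0 ≤ s) :
    ∫ t in Set.Ioi 0, radialLoss α 0 s t = zeta α 1 * s ^ (2 / α) := by
  have hd : 2 / α ∈ Set.Ioo (0 : ℝ) 1 := ⟨by positivity, (div_lt_one (by linarith)).2 hα⟩
  have hΓ_add : Real.Gamma (1 + 2 / α) = 2 / α * Real.Gamma (2 / α) := by
    rw [add_comm, Real.Gamma_add_one hd.1.ne']
  have hΓ_sub : Real.Gamma (1 - 2 / α) = -(2 / α) * Real.Gamma (-(2 / α)) := by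
    rw [← Real.Gamma_add_one (neg_ne_zero.2 hd.1.ne'), neg_add_eq_sub]
  rw [integral_Ioi_radialLoss_zero_height hα le_rfl hs, Real.zero_rpow (by linarith),
    Real.integral_rpowIntegrand₀₁_eq_rpow_mul_const hd hs, integral_Ioi_rpowIntegrand₀₁_one hd,
    zeta, hΓ_add, hΓ_sub, Real.Gamma_one]
  field_simp

/-! ### Cauchy–Stieltjes integrals and the hypergeometric function -/

lemma one_sub_mul_ne_zero {z : ℂ} (hz : z ∈ cutPlane) {w : ℝ} (hw : w ∈ Set.Icc (0 : ℝ) 1) :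
    1 - z * w ≠ 0 := by
  have hconv := Complex.starConvex_one_slitPlane (show 1 - z ∈ Complex.slitPlane from hz)
    (sub_nonneg.2 hw.2) hw.1 (sub_add_cancel 1 w)
  refine Complex.slitPlane_ne_zero (?_ : 1 - z * w ∈ Complex.slitPlane)
  convert hconv using 1
  simp only [Complex.real_smul]
  push_cast
  ring

lemma exists_pos_forall_ball_le_norm_one_sub_mul {z₀ : ℂ} (hz₀ : z₀ ∈ cutPlane) :
    ∃ c > 0, ∀ z ∈ Metric.ball z₀ c, ∀ w ∈ Set.Icc (0 : ℝ) 1, c ≤ ‖1 - z * w‖ := by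
  obtain ⟨w₀, hw₀, hmin⟩ := isCompact_Icc.exists_isMinOn (s := Set.Icc (0 : ℝ) 1)
    ⟨0, by simp⟩ (f := fun w : ℝ => ‖1 - z₀ * w‖) (by fun_prop)
  refine ⟨‖1 - z₀ * w₀‖ / 2, half_pos (norm_pos_iff.2 (one_sub_mul_ne_zero hz₀ hw₀)),
    fun z hz w hw => ?_⟩
  have hmin_w : ‖1 - z₀ * w₀‖ ≤ ‖1 - z₀ * w‖ := hmin hw
  have hdist : ‖(z - z₀) * w‖ ≤ ‖1 - z₀ * w₀‖ / 2 := by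
    rw [norm_mul, Complex.norm_real, Real.norm_of_nonneg hw.1, ← dist_eq_norm]
    exact (mul_le_of_le_one_right dist_nonneg hw.2).trans (Metric.mem_ball.1 hz).le
  have htri := norm_add_le (1 - z * w) ((z - z₀) * w)
  rw [show 1 - z * w + (z - z₀) * w = 1 - z₀ * w by ring] at htri
  linarith

section CauchyStieltjes

variable {X : Type*} [MeasurableSpace X] {μ : Measure X} {f : X → ℂ} {φ : X → ℝ}

lemma differentiableOn_integral_mul_inv_one_sub_mul (hf : Integrable f μ) (hφ : AEMeasurable φ μ)
    (hφ_mem : ∀ᵐ a ∂μ, φ a ∈ Set.Icc (0 : ℝ) 1) :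
    DifferentiableOn ℂ (fun z : ℂ => ∫ a, f a * (1 - z * φ a)⁻¹ ∂μ) cutPlane := by
  intro z₀ hz₀
  obtain ⟨c, hc, hlow⟩ := exists_pos_forall_ball_le_norm_one_sub_mul hz₀
  have hf_meas := hf.aestronglyMeasurable.aemeasurable
  have hF_meas (z : ℂ) : AEStronglyMeasurable (fun a => f a * (1 - z * φ a)⁻¹) μ :=
    AEMeasurable.aestronglyMeasurable (by fun_prop)
  have hF'_meas : AEStronglyMeasurable (fun a => f a * (φ a / (1 - z₀ * φ a) ^ 2)) μ :=
    AEMeasurable.aestronglyMeasurable (by fun_prop)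
  have hF_int : Integrable (fun a => f a * (1 - z₀ * φ a)⁻¹) μ := by
    refine (hf.norm.mul_const c⁻¹).mono' (hF_meas z₀) ?_
    filter_upwards [hφ_mem] with a ha
    rw [norm_mul, norm_inv]
    gcongr
    exact hlow z₀ (Metric.mem_ball_self hc) _ ha
  have h_bound : ∀ᵐ a ∂μ, ∀ z ∈ Metric.ball z₀ c,
      ‖f a * (φ a / (1 - z * φ a) ^ 2)‖ ≤ ‖f a‖ * (1 / c ^ 2) := by
    filter_upwards [hφ_mem] with a ha z hz
    rw [norm_mul, norm_div, norm_pow, Complex.norm_real, Real.norm_of_nonneg ha.1]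
    gcongr
    exacts [ha.2, hlow z hz _ ha]
  have h_deriv : ∀ᵐ a ∂μ, ∀ z ∈ Metric.ball z₀ c,
      HasDerivAt (fun z : ℂ => f a * (1 - z * φ a)⁻¹) (f a * (φ a / (1 - z * φ a) ^ 2)) z := by
    filter_upwards [hφ_mem] with a ha z hz
    have hne : 1 - z * φ a ≠ 0 := norm_pos_iff.1 (hc.trans_le (hlow z hz _ ha))
    have hlin : HasDerivAt (fun z : ℂ => 1 - z * φ a) (-(φ a : ℂ)) z := by
      simpa using ((hasDerivAt_id z).mul_const (φ a : ℂ)).const_sub 1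
    refine ((hlin.inv hne).const_mul (f a)).congr_deriv ?_
    rw [neg_neg]
  exact (hasDerivAt_integral_of_dominated_loc_of_deriv_le (Metric.ball_mem_nhds z₀ hc)
    (.of_forall hF_meas) hF_int hF'_meas h_bound (hf.norm.mul_const _)
    h_deriv).2.differentiableAt.differentiableWithinAt

lemma hasSum_integral_mul_inv_one_sub_mul (hf : Integrable f μ) (hφ : AEMeasurable φ μ)
    (hφ_mem : ∀ᵐ a ∂μ, φ a ∈ Set.Icc (0 : ℝ) 1) {z : ℂ} (hz : ‖z‖ < 1) :
    HasSum (fun n : ℕ => z ^ n * ∫ a, f a * (φ a : ℂ) ^ n ∂μ)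
      (∫ a, f a * (1 - z * φ a)⁻¹ ∂μ) := by
  have hf_meas := hf.aestronglyMeasurable.aemeasurable
  have hratio : ∀ᵐ a ∂μ, ‖z * φ a‖ ≤ ‖z‖ := by
    filter_upwards [hφ_mem] with a ha
    rw [norm_mul, Complex.norm_real, Real.norm_of_nonneg ha.1]
    exact mul_le_of_le_one_right (norm_nonneg z) ha.2
  have hterm (n : ℕ) : z ^ n * ∫ a, f a * (φ a : ℂ) ^ n ∂μ = ∫ a, f a * (z * φ a) ^ n ∂μ := by
    rw [← integral_const_mul]
    congr 1 with a
    ring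
  simp_rw [hterm]
  refine hasSum_integral_of_dominated_convergence (fun n a => ‖f a‖ * ‖z‖ ^ n)
    (fun n => AEMeasurable.aestronglyMeasurable (by fun_prop)) (fun n => ?_)
    (.of_forall fun a => (summable_geometric_of_lt_one (norm_nonneg z) hz).mul_left _) ?_ ?_
  · filter_upwards [hratio] with a ha
    rw [norm_mul, norm_pow]
    gcongr
  · simp_rw [tsum_mul_left]
    exact hf.norm.mul_const _
  · filter_upwards [hratio] with a ha
    exact (hasSum_geometric_of_norm_lt_one (ha.trans_lt hz)).mul_left _

end CauchyStieltjes

lemma ordinaryHypergeometric_one_add_one_of_hasSum {b z s : ℂ} (hb : -1 < b.re)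
    (hs : HasSum (fun n : ℕ => b / (b + 1 + n) * z ^ (n + 1)) s) :
    ₂F₁ 1 b (b + 1) z = 1 + s := by
  have hne (n : ℕ) : b + 1 + n ≠ 0 := fun h0 => by
    have hre := congrArg Complex.re h0
    simp only [Complex.add_re, Complex.one_re, Complex.natCast_re, Complex.zero_re] at hre
    linarith [n.cast_nonneg (α := ℝ)]
  have hpoch (n : ℕ) : (ascPochhammer ℂ n).eval (b + 1) ≠ 0 := by
    rw [Ne, ascPochhammer_eval_eq_zero_iff]
    rintro ⟨k, -, hk⟩
    exact hne k (by rw [hk, add_neg_cancel])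
  have hcoeff (n : ℕ) : ((n + 1).factorial : ℂ)⁻¹ * (ascPochhammer ℂ (n + 1)).eval 1 *
      (ascPochhammer ℂ (n + 1)).eval b * ((ascPochhammer ℂ (n + 1)).eval (b + 1))⁻¹
        = b / (b + 1 + n) := by
    have hleft : (ascPochhammer ℂ (n + 1)).eval b = b * (ascPochhammer ℂ n).eval (b + 1) := by
      simp [ascPochhammer_succ_left]
    rw [ascPochhammer_eval_one, inv_mul_cancel₀ (Nat.cast_ne_zero.2 (n + 1).factorial_ne_zero),
      one_mul, hleft, ascPochhammer_succ_eval]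
    field_simp [hne n, hpoch n]
  rw [ordinaryHypergeometric_eq_tsum]
  refine HasSum.tsum_eq ((hasSum_nat_add_iff' 1).1 ?_)
  simp only [hcoeff, smul_eq_mul, Finset.sum_range_one]
  simpa using hs

lemma integral_Ioi_one_cpow_mul_inv_pow {b : ℂ} (hb : -1 < b.re) (n : ℕ) :
    ∫ u : ℝ in Set.Ioi 1, (u : ℂ) ^ (-b - 2) * ((u⁻¹ : ℝ) : ℂ) ^ n = (b + 1 + n)⁻¹ := by
  have hre : (-(b + 2 + n)).re < -1 := by
    simp only [Complex.neg_re, Complex.add_re, Complex.natCast_re, Complex.re_ofNat]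
    linarith [n.cast_nonneg (α := ℝ)]
  have hpow : ∀ u ∈ Set.Ioi (1 : ℝ),
      (u : ℂ) ^ (-b - 2) * ((u⁻¹ : ℝ) : ℂ) ^ n = (u : ℂ) ^ (-(b + 2 + n)) := fun u hu => by
    have hu0 : (u : ℂ) ≠ 0 := Complex.ofReal_ne_zero.2 (one_pos.trans hu).ne'
    rw [Complex.ofReal_inv, inv_pow, ← Complex.cpow_natCast, ← Complex.cpow_neg,
      ← Complex.cpow_add _ _ hu0]
    congr 1
    ring
  rw [setIntegral_congr_fun measurableSet_Ioi hpow, integral_Ioi_cpow_of_lt hre one_pos,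
    Complex.ofReal_one, Complex.one_cpow, neg_div, ← one_div_neg_eq_neg_one_div, one_div]
  congr 1
  ring

-- Euler's integral `₂F₁(1, b; b + 1; z) = b ∫₀¹ w ^ (b - 1) (1 - z w)⁻¹ dw`, with one power of `w`
-- split off so that it converges for `-1 < re b`, after the substitution `w = 1 / u`.
theorem isGaussHypergeometric_one_add_one {b : ℂ} (hb : -1 < b.re) :
    IsGaussHypergeometric 1 b (b + 1) fun z =>
      1 + b * z * ∫ u : ℝ in Set.Ioi 1, (u : ℂ) ^ (-b - 2) * (1 - z * (u⁻¹ : ℝ))⁻¹ := by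
  have hint : IntegrableOn (fun u : ℝ => (u : ℂ) ^ (-b - 2)) (Set.Ioi 1) :=
    integrableOn_Ioi_cpow_of_lt (by simpa using by linarith) one_pos
  have hinv : AEMeasurable (fun u : ℝ => u⁻¹) (volume.restrict (Set.Ioi 1)) :=
    measurable_inv.aemeasurable
  have hinv_mem : ∀ᵐ u : ℝ ∂volume.restrict (Set.Ioi 1), u⁻¹ ∈ Set.Icc (0 : ℝ) 1 := by
    filter_upwards [ae_restrict_mem measurableSet_Ioi] with u hu
    exact ⟨inv_nonneg.2 (one_pos.trans hu).le, inv_le_one_of_one_le₀ (le_of_lt hu)⟩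
  refine ⟨?_, fun z hz => (ordinaryHypergeometric_one_add_one_of_hasSum hb ?_).symm⟩
  · have := differentiableOn_integral_mul_inv_one_sub_mul hint hinv hinv_mem
    fun_prop
  · have hsum := (hasSum_integral_mul_inv_one_sub_mul hint hinv hinv_mem
      (mem_ball_zero_iff.1 hz)).mul_left (b * z)
    simp only [integral_Ioi_one_cpow_mul_inv_pow hb] at hsum
    exact hsum.congr_fun fun n => by ring

lemma eta_one_eq {α s r : ℝ} (hα : 2 < α) (hs : 0 ≤ s) (hr : 0 ≤ r) :
    eta α s 1 r
      = 1 + 2 / α * ∫ u in Set.Ioi 1, Real.rpowIntegrand₀₁ (2 / α) u (s / r ^ α) := by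
  have hd : 2 / α ∈ Set.Ioo (0 : ℝ) 1 := ⟨by positivity, (div_lt_one (by linarith)).2 hα⟩
  set d := 2 / α with hd_def
  set y := s / r ^ α with hy_def
  have hy : 0 ≤ y := by positivity
  have hz : ((-y : ℝ) : ℂ) ∈ cutPlane := by
    change (1 : ℂ) - _ ∈ Complex.slitPlane
    rw [← Complex.ofReal_one, ← Complex.ofReal_sub, Complex.ofReal_mem_slitPlane]
    linarith
  have hreal : ∀ u ∈ Set.Ioi (1 : ℝ),
      (u : ℂ) ^ (-((-d : ℝ) : ℂ) - 2) * (1 - ((-y : ℝ) : ℂ) * (u⁻¹ : ℝ))⁻¹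
        = ((u ^ (d - 2) * (1 + y / u)⁻¹ : ℝ) : ℂ) := fun u hu => by
    rw [Complex.ofReal_mul, Complex.ofReal_cpow (one_pos.trans hu).le]
    push_cast
    rw [neg_neg, neg_mul, sub_neg_eq_add, div_eq_mul_inv]
  have hintegrand : ∀ u ∈ Set.Ioi (1 : ℝ),
      Real.rpowIntegrand₀₁ d u y = y * (u ^ (d - 2) * (1 + y / u)⁻¹) := fun u hu => by
    have hu0 : 0 < u := one_pos.trans hu
    rw [Real.rpowIntegrand₀₁_eq_pow_div hd hu0.le hy, show d - 2 = d - 1 - 1 by ring,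
      Real.rpow_sub_one hu0.ne' (d - 1)]
    field_simp
  have hgauss := isGaussHypergeometric_one_add_one (b := ((-d : ℝ) : ℂ)) (by simpa using hd.2)
  rw [show ((-d : ℝ) : ℂ) + 1 = ((1 - d : ℝ) : ℂ) by push_cast; ring] at hgauss
  rw [eta, one_mul, ← hd_def, ← hy_def, Complex.ofReal_one, gaussHypergeometric_eq hgauss hz,
    setIntegral_congr_fun measurableSet_Ioi hreal, integral_complex_ofReal,
    setIntegral_congr_fun measurableSet_Ioi hintegrand, integral_const_mul]
  norm_cast
  ring

/-! ### Closed forms -/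

lemma rpowIntegrand₀₁_mul {d c v s : ℝ} (hd : d ∈ Set.Ioo (0 : ℝ) 1) (hc : 0 < c) (hv : 0 ≤ v)
    (hs : 0 ≤ s) :
    Real.rpowIntegrand₀₁ d (c * v) s = c ^ (d - 1) * Real.rpowIntegrand₀₁ d v (s / c) := by
  rw [Real.rpowIntegrand₀₁_eq_pow_div hd (by positivity) hs,
    Real.rpowIntegrand₀₁_eq_pow_div hd hv (by positivity), Real.mul_rpow hc.le hv]
  field_simp

lemma integral_Ioi_radialLoss_zero_height_eq_eta {α a s : ℝ} (hα : 2 < α) (ha : 0 < a)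
    (hs : 0 ≤ s) :
    ∫ t in Set.Ioi a, radialLoss α 0 s t = a ^ 2 / 2 * (eta α s 1 a - 1) := by
  have hd : 2 / α ∈ Set.Ioo (0 : ℝ) 1 := ⟨by positivity, (div_lt_one (by linarith)).2 hα⟩
  have hc : 0 < a ^ α := Real.rpow_pos_of_pos ha α
  have hpow : a ^ α * (a ^ α) ^ (2 / α - 1) = a ^ 2 := by
    rw [mul_comm, Real.rpow_sub_one hc.ne', div_mul_cancel₀ _ hc.ne', ← Real.rpow_mul ha.le,
      mul_div_cancel₀ _ (by linarith), Real.rpow_two]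
  have hscale : ∫ u in Set.Ioi (a ^ α), Real.rpowIntegrand₀₁ (2 / α) u s
      = a ^ 2 * ∫ v in Set.Ioi 1, Real.rpowIntegrand₀₁ (2 / α) v (s / a ^ α) := by
    have hsub := integral_comp_mul_left_Ioi' (fun u => Real.rpowIntegrand₀₁ (2 / α) u s) 1 hc
    rw [mul_one, smul_eq_mul, setIntegral_congr_fun measurableSet_Ioi fun v hv =>
      rpowIntegrand₀₁_mul hd hc (zero_lt_one.trans hv).le hs, integral_const_mul,
      ← mul_assoc, hpow] at hsub
    exact hsub.symm
  rw [integral_Ioi_radialLoss_zero_height hα ha.le hs, hscale, eta_one_eq hα hs ha.le]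
  ring

lemma exp_integral_Ioi_radialLoss_zero_height (lam : ℝ) {α a s : ℝ} (hα : 2 < α) (ha : 0 < a)
    (hs : 0 ≤ s) :
    Real.exp (-2 * Real.pi * lam * ∫ t in Set.Ioi a, radialLoss α 0 s t)
      = Real.exp (-Real.pi * lam * a ^ 2 * (eta α s 1 a - 1)) := by
  rw [integral_Ioi_radialLoss_zero_height_eq_eta hα ha hs]
  congr 1
  ring

lemma laplaceIntegral_eq_exp (lam α h s : ℝ) (q : Association) {r : ℝ} (hr : 0 ≤ r) :
    laplaceIntegral lam α h q r s = Real.exp (-2 * Real.pi * lam *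
      ∫ t in Set.Ioi √(nu q r ^ 2 + h ^ 2), radialLoss α 0 s t) := by
  rw [← integral_Ioi_radialLoss_eq_zero_height h s (nu_nonneg q hr)]
  rfl

lemma laplaceIntegral_zero_height (lam : ℝ) {α r s : ℝ} (q : Association) (hα : 2 < α)
    (hr : 0 < r) (hs : 0 ≤ s) :
    laplaceIntegral lam α 0 q r s = laplaceNonElevated lam α q r s := by
  cases q with
  | closest => exact exp_integral_Ioi_radialLoss_zero_height lam hα hr hs
  | strongest =>
    change Real.exp (_ * ∫ t in Set.Ioi 0, radialLoss α 0 s t) = Real.exp _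
    rw [integral_Ioi_zero_radialLoss_zero_height hα hs, ← mul_assoc]

lemma laplaceIntegral_eq_laplaceNonElevated_mul_exp (lam : ℝ) {α r s : ℝ} (h : ℝ)
    (q : Association) (hα : 2 < α) (hr : 0 < r) (hs : 0 ≤ s) :
    laplaceIntegral lam α h q r s = laplaceNonElevated lam α q r s *
      Real.exp (2 * Real.pi * lam *
        ∫ t in nu q r..√(nu q r ^ 2 + h ^ 2), (1 - 1 / (1 + s * t ^ (-α))) * t) := by
  have hν := nu_nonneg q hr.le
  set b := √(nu q r ^ 2 + h ^ 2) with hb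
  have hb_nonneg : 0 ≤ b := Real.sqrt_nonneg _
  have hint := integrableOn_radialLoss_zero_height hα hs
  have hsplit : (∫ t in nu q r..b, radialLoss α 0 s t) + ∫ t in Set.Ioi b, radialLoss α 0 s t
      = ∫ t in Set.Ioi (nu q r), radialLoss α 0 s t :=
    intervalIntegral.integral_interval_add_Ioi (hint.mono_set (Set.Ioi_subset_Ioi hν))
      (hint.mono_set (Set.Ioi_subset_Ioi hb_nonneg))
  have hpathloss : ∫ t in nu q r..b, (1 - 1 / (1 + s * t ^ (-α))) * t
      = ∫ t in nu q r..b, radialLoss α 0 s t :=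
    intervalIntegral.integral_congr fun t ht => by
      simp only [radialLoss, pathloss_zero_height α ((le_inf hν hb_nonneg).trans ht.1)]
  have hzero : laplaceIntegral lam α 0 q r s
      = Real.exp (-2 * Real.pi * lam * ∫ t in Set.Ioi (nu q r), radialLoss α 0 s t) := rfl
  rw [← laplaceIntegral_zero_height lam q hα hr hs, hzero, laplaceIntegral_eq_exp lam α h s q hr.le,
    hpathloss, ← hsplit, ← hb, ← Real.exp_add]
  congr 1
  ring

end ElevatedBS

end

theorem mainTheorem8 {Ω : Type*} [MeasurableSpace Ω] (P : Measure Ω) [IsProbabilityMeasure P]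
    (lam α : ℝ) (hlam : 0 < lam) (hα : 2 < α)
    (x : ℕ → Ω → ElevatedBS.Plane) (g : ℕ → Ω → ℝ)
    (hnet : ElevatedBS.IsRayleighNetwork P lam x g)
    (h r s : ℝ) (hh : 0 < h) (hr : 0 < r) (hs : 0 ≤ s) :
    -- the Laplace transforms of the interference with non-elevated base stations
    (∀ q, ElevatedBS.laplaceTransform P (ElevatedBS.interference x g α 0 q r) s
        = ElevatedBS.laplaceNonElevated lam α q r s) ∧
    -- the Laplace transforms of the interference with elevated base stations, as integrals
    (∀ q, ElevatedBS.laplaceTransform P (ElevatedBS.interference x g α h q r) s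
        = ElevatedBS.laplaceIntegral lam α h q r s) ∧
    -- closest association
    (ElevatedBS.laplaceTransform P (ElevatedBS.interference x g α h .closest r) s
        = ElevatedBS.laplaceNonElevated lam α .closest r s *
          Real.exp (2 * Real.pi * lam *
            ∫ t in r..√(r ^ 2 + h ^ 2), (1 - 1 / (1 + s * t ^ (-α))) * t)) ∧
    (ElevatedBS.laplaceTransform P (ElevatedBS.interference x g α h .closest r) s
        = Real.exp (-Real.pi * lam * (r ^ 2 + h ^ 2) *
            (ElevatedBS.eta α s 1 (√(r ^ 2 + h ^ 2)) - 1))) ∧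
    -- strongest association
    (ElevatedBS.laplaceTransform P (ElevatedBS.interference x g α h .strongest r) s
        = ElevatedBS.laplaceNonElevated lam α .strongest r s *
          Real.exp (2 * Real.pi * lam *
            ∫ t in (0 : ℝ)..h, (1 - 1 / (1 + s * t ^ (-α))) * t)) ∧
    (ElevatedBS.laplaceTransform P (ElevatedBS.interference x g α h .strongest r) s
        = Real.exp (-Real.pi * lam * h ^ 2 * (ElevatedBS.eta α s 1 h - 1))) := by
  have hI := fun H q => hnet.laplaceTransform_interference hlam.le H q hα hr.le hs
  refine ⟨fun q => ?_, fun q => hI h q, ?_, ?_, ?_, ?_⟩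
  · rw [hI, ElevatedBS.laplaceIntegral_zero_height lam q hα hr hs]
  · rw [hI, ElevatedBS.laplaceIntegral_eq_laplaceNonElevated_mul_exp lam h _ hα hr hs,
      ElevatedBS.nu]
  · rw [hI, ElevatedBS.laplaceIntegral_eq_exp lam α h s _ hr.le, ElevatedBS.nu,
      ElevatedBS.exp_integral_Ioi_radialLoss_zero_height lam hα (by positivity) hs,
      Real.sq_sqrt (by positivity)]
  · rw [hI, ElevatedBS.laplaceIntegral_eq_laplaceNonElevated_mul_exp lam h _ hα hr hs,
      ElevatedBS.nu, zero_pow two_ne_zero, zero_add, Real.sqrt_sq hh.le]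
  · rw [hI, ElevatedBS.laplaceIntegral_eq_exp lam α h s _ hr.le, ElevatedBS.nu,
      zero_pow two_ne_zero, zero_add, Real.sqrt_sq hh.le,
      ElevatedBS.exp_integral_Ioi_radialLoss_zero_height lam hα hh hs]
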